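/- Let $(X,\mu)$ be a standard probability space; "measurable" means measurable for the completion of $\mu$. Let $\mathcal{S}\subseteq\mathcal{R}\subseteq X\times X$ be discrete, measure-preserving equivalence relations: each is a Borel equivalence relation, almost every class is countable, and the flip $(x,y)\mapsto(y,x)$ preserves the measure $A\mapsto\int_X|\{y:(x,y)\in A\}|\,d\mu(x)$ on Borel subsets $A$ of the relation. Assume that $\mathcal{R}$ is ergodic, i.e. every $\mathcal{R}$-invariant measurable set is null or conull. Write $[x]_{\mathcal{R}}$ for the $\mathcal{R}$-class of $x$, and $[x]_{\mathcal{R}}/\mathcal{S}$ for the set of $\mathcal{S}$-classes contained in it. Let $[\mathcal{R}]$ be the group of bimeasurable bijections $\gamma$ of $X$ with $\gamma(x)\in[x]_{\mathcal{R}}$ for almost every $x$ (modulo a.e. equality). Let $L^2(\mathcal{R}/\mathcal{S})=\int_X^{\oplus}\ell^2([x]_{\mathcal{R}}/\mathcal{S})\,d\mu(x)$, the space of families $\xi=(\xi_x)_{x\in X}$, $\xi_x\in\ell^2([x]_{\mathcal{R}}/\mathcal{S})$, modulo a.e. equality, such that $x\mapsto\xi_x([\gamma(x)]_{\mathcal{S}})$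 is measurable for every $\gamma\in[\mathcal{R}]$ and $\int_X\|\xi_x\|^2\,d\mu(x)<\infty$. The group $[\mathcal{R}]$ acts on it by $(\gamma\xi)_x=\xi_{\gamma^{-1}(x)}$, using $\ell^2([\gamma^{-1}(x)]_{\mathcal{R}}/\mathcal{S})=\ell^2([x]_{\mathcal{R}}/\mathcal{S})$ for almost every $x$. Then $L^2(\mathcal{R}/\mathcal{S})$ has a nonzero $[\mathcal{R}]$-invariant vector if and only if there is an $\mathcal{S}$-invariant measurable set $E\subseteq X$ with $\mu(E)>0$ and $[\mathcal{R}|_E:\mathcal{S}|_E]<\infty$. Here $\mathcal{R}|_E=\mathcal{R}\cap(E\times E)$ and $\mathcal{S}|_E=\mathcal{S}\cap(E\times E)$ are regarded as relations on $E$ with the measure $\mu(E\cap\cdot)/\mu(E)$, and the index $[\mathcal{R}|_E:\mathcal{S}|_E]$ is the almost sure value of the number of $\mathcal{S}|_E$-classes in the $\mathcal{R}|_E$-class of $x$. -/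

import Mathlib

open MeasureTheory
open scoped ENNReal

noncomputable section

namespace MeasuredRel

universe u

/-- The mass `μ_R(A) = ∫ |{y : (x, y) ∈ A}| dμ(x)` of a set `A ⊆ X × X`. -/
def relMass {X : Type u} [MeasurableSpace X] (μ : Measure X) (A : Set (X × X)) : ℝ≥0∞ :=
  ∫⁻ x, (({y | (x, y) ∈ A}.encard : ℕ∞) : ℝ≥0∞) ∂μ

/-- `R` is a discrete, measure-preserving (Borel) equivalence relation over `(X, μ)`. -/
structure IsDiscreteMP {X : Type u} [MeasurableSpace X] (μ : Measure X) (R : Setoid X) :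
    Prop where
  /-- The graph of `R` is a Borel subset of `X × X`. -/
  measurableSet_graph : MeasurableSet {p : X × X | R p.1 p.2}
  /-- Almost every class is countable. -/
  ae_countable : ∀ᵐ x ∂μ, {y | R x y}.Countable
  /-- The flip `(x, y) ↦ (y, x)` preserves `μ_R` on Borel subsets of the graph of `R`. -/
  flip_preserving : ∀ A : Set (X × X), MeasurableSet A → A ⊆ {p : X × X | R p.1 p.2} →
    relMass μ (Prod.swap ⁻¹' A) = relMass μ A

/-- `A` is `R`-invariant: a union of `R`-classes. -/
def IsInvariant {X : Type u} (R : Setoid X) (A : Set X) : Prop :=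
  ∀ x y, R x y → x ∈ A → y ∈ A

/-- `R` is ergodic: invariant measurable sets (measurable for the completion of `μ`) are null or
conull. -/
def IsErgodic {X : Type u} [MeasurableSpace X] (μ : Measure X) (R : Setoid X) : Prop :=
  ∀ A : Set X, NullMeasurableSet A μ → IsInvariant R A → μ A = 0 ∨ μ Aᶜ = 0

/-- The full group `[R]`: bijections `γ` of `X`, bimeasurable for the completion of `μ`, with
`γ x ∈ [x]_R` for almost every `x`. (Elements are not identified when they agree a.e.) -/
def fullGroup {X : Type u} [MeasurableSpace X] (μ : Measure X) (R : Setoid X) :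
    Set (Equiv.Perm X) :=
  {γ | (∀ A : Set X, NullMeasurableSet A μ → NullMeasurableSet (γ ⁻¹' A) μ) ∧
    (∀ A : Set X, NullMeasurableSet A μ → NullMeasurableSet (γ '' A) μ) ∧
    ∀ᵐ x ∂μ, R x (γ x)}

/-- `[x]_R / S`: the set of `S`-classes of the points of `[x]_R`. -/
def cosets {X : Type u} (R S : Setoid X) (x : X) : Set (Quotient S) :=
  (fun y => (Quotient.mk S y)) '' {y | R x y}

theorem mk_mem_cosets {X : Type u} (R S : Setoid X) {x y : X} (h : R x y) :
    Quotient.mk S y ∈ cosets R S x :=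
  ⟨y, h, rfl⟩

theorem cosets_eq {X : Type u} (R S : Setoid X) {x y : X} (h : R x y) :
    cosets R S y = cosets R S x := by
  have : {z | R y z} = {z | R x z} :=
    Set.ext fun z => ⟨fun hz => R.trans' h hz, fun hz => R.trans' (R.symm' h) hz⟩
  unfold cosets
  rw [this]

/-- The fibre `ℓ²([x]_R / S)`. -/
abbrev Fibre {X : Type u} (R S : Setoid X) (x : X) : Type u :=
  lp (fun _ : cosets R S x => ℂ) 2

/-- The identity `ℓ²(A) → ℓ²(B)` for equal index sets `A = B`. -/
def lpCast {Q : Type u} {A B : Set Q} (h : A = B) :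
    lp (fun _ : A => ℂ) 2 ≃ₗᵢ[ℂ] lp (fun _ : B => ℂ) 2 := by
  subst h
  exact LinearIsometryEquiv.refl ℂ _

theorem lpCast_apply {Q : Type u} {A B : Set Q} (h : A = B) (f : lp (fun _ : A => ℂ) 2) (b : B) :
    lpCast h f b = f ⟨b.1, h.symm ▸ b.2⟩ := by
  subst h
  rfl

/-- The quasi-regular representation `λ_{R/S}(x, y) = id : ℓ²([y]_R / S) → ℓ²([x]_R / S)`,
for `(x, y) ∈ R`. -/
def quasiRegular {X : Type u} (R S : Setoid X) {x y : X} (h : R x y) :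
    Fibre R S y ≃ₗᵢ[ℂ] Fibre R S x :=
  lpCast (cosets_eq R S h)

open Classical in
/-- The coefficient `ξ_x([y]_S)` for `(x, y) ∈ R` (and `0` for other pairs). -/
def coeff {X : Type u} (R S : Setoid X) (ξ : ∀ x, Fibre R S x) (x y : X) : ℂ :=
  if h : R x y then ξ x ⟨Quotient.mk S y, mk_mem_cosets R S h⟩ else 0

/-- `ξ` is a measurable section of `x ↦ ℓ²([x]_R / S)`: for every `γ ∈ [R]` the function
`x ↦ ξ_x([γ x]_S)` is measurable for the completion of `μ`. -/
def IsMeasurableSection {X : Type u} [MeasurableSpace X] (μ : Measure X) (R S : Setoid X)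
    (ξ : ∀ x, Fibre R S x) : Prop :=
  ∀ γ ∈ fullGroup μ R, AEMeasurable (fun x => coeff R S ξ x (γ x)) μ

/-- `ξ` represents a vector of `L²(R/S) = ∫^⊕ ℓ²([x]_R / S) dμ(x)`: it is a measurable section
with `∫ ‖ξ_x‖² dμ(x) < ∞`. Two such sections represent the same vector iff they agree a.e. -/
def MemL2 {X : Type u} [MeasurableSpace X] (μ : Measure X) (R S : Setoid X)
    (ξ : ∀ x, Fibre R S x) : Prop :=
  IsMeasurableSection μ R S ξ ∧ ∫⁻ x, ‖ξ x‖ₑ ^ 2 ∂μ < ∞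

open Classical in
/-- The operator of `γ ∈ [R]` on sections: `(λ(γ) ξ)_x = λ_{R/S}(x, γ⁻¹ x) ξ_{γ⁻¹ x}`
(which makes sense for almost every `x`). -/
def fullGroupAct {X : Type u} (R S : Setoid X) (γ : Equiv.Perm X) (ξ : ∀ x, Fibre R S x) :
    ∀ x, Fibre R S x :=
  fun x => if h : R x (γ.symm x) then quasiRegular R S h (ξ (γ.symm x)) else 0

/-- `L²(R/S)` has a nonzero `[R]`-invariant vector. -/
def HasNonzeroInvariantVector {X : Type u} [MeasurableSpace X] (μ : Measure X)
    (R S : Setoid X) : Prop :=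
  ∃ ξ : ∀ x, Fibre R S x, MemL2 μ R S ξ ∧ (¬ ∀ᵐ x ∂μ, ξ x = 0) ∧
    ∀ γ ∈ fullGroup μ R, ∀ᵐ x ∂μ, fullGroupAct R S γ ξ x = ξ x

/-- `[R : S] = n`: almost every `R`-class consists of exactly `n` classes of `S`. -/
def HasIndex {X : Type u} [MeasurableSpace X] (μ : Measure X) (R S : Setoid X) (n : ℕ∞) : Prop :=
  ∀ᵐ x ∂μ, (cosets R S x).encard = n

/-- The restriction `R|_E = R ∩ (E × E)`, as an equivalence relation on `E`. -/
def restrictRel {X : Type u} (R : Setoid X) (E : Set X) : Setoid E :=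
  R.comap Subtype.val

/-- The normalized measure `μ(E ∩ ·) / μ(E)`, as a measure on `E`. -/
def restrictMeasure {X : Type u} [MeasurableSpace X] (μ : Measure X) (E : Set X) : Measure E :=
  (μ E)⁻¹ • μ.comap Subtype.val

end MeasuredRel

end

/-! A vector invariant under `[R]` satisfies `ξ_y = ξ_x` for a.e. `x` and all `y ∈ [x]_R`, so it is
determined by the `S`-invariant function `F(x) = ξ_x([x]_S)`: its coordinates are `ξ_x([y]_S) =
F(y)`. If `ξ ≠ 0`, some level set `E = {|F| > ε}` is non-null, and since `ξ_x` is in `ℓ²`, only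
finitely many `S`-classes in `[x]_R` meet `E`. Their number is constant along `R`-classes, hence
a.e. constant by ergodicity. Conversely, if `S|_E` has index `n` in `R|_E`, the indicators of the
classes that meet `E` form an invariant family of norm at most `√n`.

Passing from invariance under each `γ`, off a null set depending on `γ`, to constancy on whole
classes requires countably many elements of `[R]` whose graphs cover `R`
(`exists_involutive_cover`). They are built from Borel graphs covering `R`
(`exists_measurable_graph_cover`), made into involutions by `exchange`. Statements up to null sets
suffice throughout: `AnalyticSet.nullMeasurableSet` handles projections, and `ae_forall_rel` shows
that null sets have null saturation. -/

namespace MeasureTheory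

open Set Filter Topology

/-! ### Measurability of analytic sets, and maximal families up to null sets -/

/-- The image under a continuous map of a set with large (outer) measure can be bounded
coordinatewise without losing much measure. -/
theorem exists_bound_lt_measure_image {α : Type*} [MeasurableSpace α] (μ : Measure α)
    (f : (ℕ → ℕ) → α) {t : ℝ≥0∞} (ht : t < μ (range f)) :
    ∃ b : ℕ → ℕ, ∀ n, t < μ (f '' {z | ∀ i < n, z i ≤ b i}) := by
  have step : ∀ (n : ℕ) (A : Set (ℕ → ℕ)), t < μ (f '' A) →
      ∃ k, t < μ (f '' (A ∩ {z | z n ≤ k})) := by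
    intro n A hA
    have hmono : Monotone fun k : ℕ => f '' (A ∩ {z | z n ≤ k}) := fun k l hkl =>
      image_mono fun z hz => ⟨hz.1, le_trans hz.2 hkl⟩
    have hU : (⋃ k : ℕ, f '' (A ∩ {z | z n ≤ k})) = f '' A := by
      rw [← image_iUnion, ← inter_iUnion]
      congr 1
      exact inter_eq_left.2 fun z _ => mem_iUnion.2 ⟨z n, le_refl (z n)⟩
    -- Continuity from below holds for arbitrary sets, so the images need not be known to be
    -- measurable.
    rw [← hU, hmono.directed_le.measure_iUnion] at hA
    exact lt_iSup_iff.1 hA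
  choose! k hk using step
  let A : ℕ → Set (ℕ → ℕ) := fun n =>
    Nat.rec univ (fun n A => A ∩ {z | z n ≤ k n A}) n
  have hA : ∀ n, t < μ (f '' A n) := by
    intro n
    induction n with
    | zero => simpa [A] using ht
    | succ n ih => exact hk n _ ih
  refine ⟨fun n => k n (A n), fun n => ?_⟩
  have : A n = {z | ∀ i < n, z i ≤ k i (A i)} := by
    induction n with
    | zero => simp [A]
    | succ n ih =>
      change A n ∩ {z | z n ≤ k n (A n)} = _
      ext z
      rw [mem_inter_iff]
      nth_rw 1 [ih]
      simp only [mem_ofPred_eq, Nat.lt_succ_iff_lt_or_eq]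
      constructor
      · rintro ⟨h, h'⟩ i (hi | rfl)
        exacts [h i hi, h']
      · exact fun h => ⟨fun i hi => h i (Or.inl hi), h n (Or.inr rfl)⟩
  rw [← this]
  exact hA n

theorem isCompact_setOf_forall_le (b : ℕ → ℕ) : IsCompact {z : ℕ → ℕ | ∀ i, z i ≤ b i} := by
  have := isCompact_univ_pi (s := fun i => Iic (b i)) fun i => (finite_Iic (b i)).isCompact
  convert this using 1
  ext z
  simp [Pi.le_def]

/-- An open set containing the compact box of sequences bounded by `b` contains one of the boxes
in which only finitely many coordinates are bounded. -/
theorem exists_setOf_forall_lt_subset (b : ℕ → ℕ) {U : Set (ℕ → ℕ)} (hU : IsOpen U)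
    (hb : {z : ℕ → ℕ | ∀ i, z i ≤ b i} ⊆ U) : ∃ n, {z : ℕ → ℕ | ∀ i < n, z i ≤ b i} ⊆ U := by
  have hcyl : ∀ z ∈ U, ∃ n, PiNat.cylinder z n ⊆ U := by
    intro z hz
    obtain ⟨V, ⟨w, n, rfl⟩, hzV, hV⟩ :=
      (PiNat.isTopologicalBasis_cylinders fun _ : ℕ => ℕ).exists_subset_of_mem_open hz hU
    exact ⟨n, (PiNat.mem_cylinder_iff_eq.1 hzV).symm ▸ hV⟩
  choose! n hn using hcyl
  obtain ⟨T, hTK, hT⟩ := (isCompact_setOf_forall_le b).elim_nhds_subcover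
    (fun z => PiNat.cylinder z (n z))
    fun z _ => (PiNat.isOpen_cylinder _ z (n z)).mem_nhds (PiNat.self_mem_cylinder z (n z))
  refine ⟨T.sup n, fun w hw => ?_⟩
  -- Replacing the unbounded tail of `w` by zeros gives a point of the compact box, which shares
  -- with `w` all coordinates that the finite subcover inspects.
  have hmem : (fun i => if i < T.sup n then w i else 0) ∈ {z : ℕ → ℕ | ∀ i, z i ≤ b i} := by
    intro i
    dsimp only
    split_ifs with h
    exacts [hw i h, Nat.zero_le _]
  obtain ⟨z, hz, hwz⟩ := mem_iUnion₂.1 (hT hmem)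
  refine hn z (hb (hTK z hz)) fun i hi => ?_
  have := hwz i hi
  dsimp only at this
  rwa [if_pos (hi.trans_le (Finset.le_sup hz))] at this

/-- Analytic sets are measurable for the completion of every finite Borel measure. -/
theorem AnalyticSet.nullMeasurableSet {α : Type*} [TopologicalSpace α] [PolishSpace α]
    [MeasurableSpace α] [BorelSpace α] (μ : Measure α) [IsFiniteMeasure μ] {s : Set α}
    (hs : AnalyticSet s) : NullMeasurableSet s μ := by
  rw [AnalyticSet] at hs
  rcases hs with rfl | ⟨f, hf, rfl⟩
  · exact nullMeasurableSet_empty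
  have key : ∀ t < μ (range f), ∃ K ⊆ range f, MeasurableSet K ∧ t ≤ μ K := by
    intro t ht
    obtain ⟨b, hb⟩ := exists_bound_lt_measure_image μ f ht
    have hK := (isCompact_setOf_forall_le b).image hf
    refine ⟨_, image_subset_range _ _, hK.isClosed.measurableSet, ?_⟩
    -- By outer regularity it suffices to bound open `U ⊇ K`. Compactness puts the image of a
    -- finitely constrained box inside `U`, and that image already has measure above `t`.
    refine le_of_forall_gt fun r hr => ?_
    obtain ⟨U, hKU, hU, hUr⟩ := exists_isOpen_lt_of_lt _ r hr
    obtain ⟨n, hn⟩ := exists_setOf_forall_lt_subset b (hU.preimage hf) (image_subset_iff.1 hKU)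
    exact ((hb n).trans_le (measure_mono (image_subset_iff.2 hn))).trans hUr
  rcases eq_or_ne (μ (range f)) 0 with h0 | h0
  · exact NullMeasurableSet.of_null h0
  obtain ⟨u, -, hu, hlim⟩ := exists_seq_strictMono_tendsto' (pos_iff_ne_zero.2 h0)
  choose K hKs hKm hK using fun n => key (u n) (hu n).2
  have hle : μ (range f) ≤ μ (⋃ n, K n) :=
    le_of_tendsto' hlim fun n => (hK n).trans (measure_mono (subset_iUnion K n))
  have hKU : NullMeasurableSet (⋃ n, K n) μ := (MeasurableSet.iUnion hKm).nullMeasurableSet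
  exact hKU.congr (ae_eq_of_subset_of_measure_ge (iUnion_subset hKs) hle hKU (measure_ne_top _ _))

/-- Borel images of Borel sets between standard Borel spaces are measurable for the completion of
every finite measure. -/
theorem _root_.MeasurableSet.nullMeasurableSet_image {X Y : Type*} [MeasurableSpace X]
    [StandardBorelSpace X] [MeasurableSpace Y] [StandardBorelSpace Y] (μ : Measure Y)
    [IsFiniteMeasure μ] {s : Set X} (hs : MeasurableSet s) {f : X → Y} (hf : Measurable f) :
    NullMeasurableSet (f '' s) μ := by
  let := upgradeStandardBorel Y
  exact (hs.analyticSet_image hf).nullMeasurableSet μ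

/-- A family of measurable sets that is closed under countable unions has a member that contains
every other one up to a null set. -/
theorem exists_measurableSet_maximal {X : Type*} [MeasurableSpace X] (μ : Measure X)
    [IsFiniteMeasure μ] (P : Set X → Prop) (h0 : P ∅)
    (hP : ∀ C : ℕ → Set X, (∀ n, P (C n)) → P (⋃ n, C n)) :
    ∃ C, MeasurableSet C ∧ P C ∧ ∀ D, MeasurableSet D → P D → μ (D \ C) = 0 := by
  let S : Set ℝ≥0∞ := μ '' {C | MeasurableSet C ∧ P C}
  have hne : S.Nonempty := ⟨_, ∅, ⟨MeasurableSet.empty, h0⟩, rfl⟩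
  obtain ⟨u, -, hu, huS⟩ := exists_seq_tendsto_sSup hne (OrderTop.bddAbove S)
  choose C hC hCu using huS
  have hCm : MeasurableSet (⋃ n, C n) := MeasurableSet.iUnion fun n => (hC n).1
  have hge : sSup S ≤ μ (⋃ n, C n) :=
    le_of_tendsto' hu fun n => hCu n ▸ measure_mono (subset_iUnion C n)
  refine ⟨⋃ n, C n, hCm, hP C fun n => (hC n).2, fun D hD hPD => ?_⟩
  -- The union attains the supremum of the measures, so adjoining `D` cannot increase its measure.
  have hU : P ((⋃ n, C n) ∪ D) := by
    have := hP (fun n => Nat.casesOn n D C) (by rintro (_ | n); exacts [hPD, (hC n).2])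
    convert this using 1
    ext x
    simp only [mem_union, mem_iUnion]
    constructor
    · rintro (⟨n, h⟩ | h)
      exacts [⟨n + 1, h⟩, ⟨0, h⟩]
    · rintro ⟨_ | n, h⟩
      exacts [Or.inr h, Or.inl ⟨n, h⟩]
  have hle : μ ((⋃ n, C n) ∪ D) ≤ μ (⋃ n, C n) :=
    (le_sSup (show _ ∈ S from ⟨_, ⟨hCm.union hD, hU⟩, rfl⟩)).trans hge
  have h1 := ae_eq_of_subset_of_measure_ge subset_union_left hle hCm.nullMeasurableSet
    (measure_ne_top _ _)
  have h2 := ae_le_set.1 h1.symm.le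
  rwa [union_sdiff_left] at h2

end MeasureTheory

namespace MeasureTheory

open Set Filter Topology

/-! ### Lusin–Novikov uniformization almost everywhere -/

/-- Over almost every point, the part of `B` in the fibre of `p` is enumerated by countably many
measurable functions. -/
def FibresCovered {X Z : Type*} [MeasurableSpace X] [MeasurableSpace Z] (μ : Measure X)
    (p : Z → X) (B : Set Z) : Prop :=
  ∃ g : ℕ → X → Z, (∀ n, Measurable (g n)) ∧ ∀ᵐ x ∂μ, ∀ z ∈ B, p z = x → ∃ n, g n x = z

section FibresCovered

variable {X Z : Type*} [MeasurableSpace X] [MeasurableSpace Z] {μ : Measure X} {p : Z → X}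

theorem FibresCovered.mono {A B : Set Z} (hB : FibresCovered μ p B) (h : A ⊆ B) :
    FibresCovered μ p A := by
  obtain ⟨g, hg, hgB⟩ := hB
  exact ⟨g, hg, hgB.mono fun x hx z hz => hx z (h hz)⟩

theorem FibresCovered.iUnion {ι : Type*} [Countable ι] [Nonempty ι] {B : ι → Set Z}
    (hB : ∀ i, FibresCovered μ p (B i)) : FibresCovered μ p (⋃ i, B i) := by
  choose g hg hgB using hB
  obtain ⟨e, he⟩ := exists_surjective_nat (ι × ℕ)
  refine ⟨fun n => g (e n).1 (e n).2, fun n => hg _ _, ?_⟩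
  filter_upwards [ae_all_iff.2 hgB] with x hx z hz hzx
  obtain ⟨i, hi⟩ := mem_iUnion.1 hz
  obtain ⟨n, hn⟩ := hx i z hi hzx
  obtain ⟨m, hm⟩ := he (i, n)
  exact ⟨m, by rw [hm]; exact hn⟩

theorem FibresCovered.union {A B : Set Z} (hA : FibresCovered μ p A) (hB : FibresCovered μ p B) :
    FibresCovered μ p (A ∪ B) := by
  rw [union_eq_iUnion]
  exact FibresCovered.iUnion (by rintro (_ | _); exacts [hB, hA])

theorem FibresCovered.of_injOn [StandardBorelSpace X] [StandardBorelSpace Z] [Nonempty Z]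
    (hp : Measurable p) {B : Set Z} (hB : MeasurableSet B) (hinj : InjOn p B) :
    FibresCovered μ p B := by
  have := hB.standardBorel
  have hemb : MeasurableEmbedding (fun z : B => p z) :=
    (hp.comp measurable_subtype_coe).measurableEmbedding
      fun z w h => Subtype.ext (hinj z.2 w.2 h)
  obtain ⟨g, hg, hgB⟩ := hemb.exists_measurable_extend (g := fun z : B => (z : Z))
    measurable_subtype_coe fun _ => inferInstance
  refine ⟨fun _ => g, fun _ => hg, Eventually.of_forall fun x z hz hzx => ⟨0, ?_⟩⟩
  rw [← hzx]
  exact congrFun hgB ⟨z, hz⟩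

/-- The set of points whose fibre meets `B` in exactly one point. -/
theorem nullMeasurableSet_existsUnique [StandardBorelSpace X] [StandardBorelSpace Z]
    [IsFiniteMeasure μ] (hp : Measurable p) {B : Set Z} (hB : MeasurableSet B) :
    NullMeasurableSet {x | ∃! z, z ∈ B ∧ p z = x} μ := by
  have h1 : NullMeasurableSet (p '' B) μ := hB.nullMeasurableSet_image μ hp
  have hT : MeasurableSet {w : Z × Z | w.1 ∈ B ∧ w.2 ∈ B ∧ p w.1 = p w.2 ∧ w.1 ≠ w.2} :=
    (measurable_fst hB).inter ((measurable_snd hB).inter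
      ((measurableSet_eq_fun (hp.comp measurable_fst) (hp.comp measurable_snd)).inter
        (measurableSet_eq_fun measurable_fst measurable_snd).compl))
  have h2 := hT.nullMeasurableSet_image μ (hp.comp measurable_fst)
  convert h1.diff h2 using 1
  ext x
  constructor
  · rintro ⟨z, ⟨hz, rfl⟩, hu⟩
    refine ⟨⟨z, hz, rfl⟩, ?_⟩
    rintro ⟨⟨v, w⟩, ⟨hv, hw, hvw, hne⟩, hvz⟩
    exact hne ((hu v ⟨hv, hvz⟩).trans (hu w ⟨hw, hvw.symm.trans hvz⟩).symm)
  · rintro ⟨⟨z, hz, rfl⟩, hnot⟩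
    refine ⟨z, ⟨hz, rfl⟩, fun w hw => by_contra fun hne => hnot ?_⟩
    exact ⟨(w, z), ⟨hw.1, hz, hw.2, hne⟩, hw.2⟩

/-- A nonempty countable closed subset of a Polish space has an isolated point, in the strong sense
that some basic open set meets it in exactly one point. -/
theorem exists_basis_inter_eq_singleton {Z : Type*} [TopologicalSpace Z] [PolishSpace Z]
    {C : Set Z} (hC : IsClosed C) (hCc : C.Countable) (hne : C.Nonempty) :
    ∃ V ∈ TopologicalSpace.countableBasis Z, ∃ z, V ∩ C = {z} := by
  -- A nonempty perfect set would contain a copy of Cantor space, contradicting countability.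
  by_cases hperf : Preperfect C
  · let := TopologicalSpace.upgradeIsCompletelyMetrizable Z
    obtain ⟨f, hf, -, hinj⟩ := Perfect.exists_nat_bool_injection ⟨hC, hperf⟩ hne
    have : (univ : Set (ℕ → Bool)).Countable :=
      MapsTo.countable_of_injOn (fun b _ => hf (mem_range_self b)) hinj.injOn hCc
    refine absurd (Cardinal.mk_le_aleph0_iff.2 (countable_univ_iff.1 this)) (not_le.2 ?_)
    simpa using Cardinal.cantor Cardinal.aleph0
  · rw [preperfect_iff_nhds] at hperf
    push Not at hperf
    obtain ⟨x, hx, U, hU, hUx⟩ := hperf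
    obtain ⟨V, hV, hxV, hVU⟩ :=
      (TopologicalSpace.isBasis_countableBasis Z).mem_nhds_iff.1 hU
    refine ⟨V, hV, x, subset_antisymm (fun y hy => hUx y ⟨hVU hy.1, hy.2⟩) ?_⟩
    rintro _ rfl
    exact ⟨hxV, hx⟩

/-- **Lusin–Novikov**, almost everywhere, for a continuous map. -/
theorem fibresCovered_univ_of_continuous [StandardBorelSpace X] [TopologicalSpace X] [T1Space X]
    [TopologicalSpace Z] [PolishSpace Z] [BorelSpace Z] [Nonempty Z] [IsFiniteMeasure μ]
    (hp : Continuous p) (hpm : Measurable p) (hc : ∀ᵐ x ∂μ, (p ⁻¹' {x}).Countable) :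
    FibresCovered μ p univ := by
  let ι := TopologicalSpace.countableBasis Z
  have hι : Countable ι := (TopologicalSpace.countable_countableBasis Z).to_subtype
  -- For each basic open `V`, take an essentially largest base set over which `V` is covered; `B`
  -- below collects these covered pieces.
  have hmax : ∀ V : ι, ∃ C, MeasurableSet C ∧ FibresCovered μ p ((V : Set Z) ∩ p ⁻¹' C) ∧
      ∀ D, MeasurableSet D → FibresCovered μ p ((V : Set Z) ∩ p ⁻¹' D) → μ (D \ C) = 0 := by
    intro V
    refine exists_measurableSet_maximal μ (fun C => FibresCovered μ p ((V : Set Z) ∩ p ⁻¹' C))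
      ?_ ?_
    · exact ⟨fun _ _ => Classical.arbitrary Z, fun _ => measurable_const,
        Eventually.of_forall fun x z hz => absurd hz.2 (notMem_empty _)⟩
    · intro C hC
      rw [preimage_iUnion, inter_iUnion]
      exact FibresCovered.iUnion hC
  choose C hCm hC hCmax using hmax
  have hopen : ∀ V : ι, IsOpen (V : Set Z) := fun V =>
    TopologicalSpace.isOpen_of_mem_countableBasis V.2
  let B : Set Z := ⋃ V : ι, (V : Set Z) ∩ p ⁻¹' C V
  have hBm : MeasurableSet B := MeasurableSet.iUnion fun V =>
    (hopen V).measurableSet.inter (hpm (hCm V))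
  rcases isEmpty_or_nonempty ι with hιe | hιn
  · obtain ⟨V, hV, -⟩ := (TopologicalSpace.isBasis_countableBasis Z).exists_subset_of_mem_open
      (mem_univ (Classical.arbitrary Z)) isOpen_univ
    exact hιe.elim ⟨V, hV⟩
  have hB : FibresCovered μ p B := FibresCovered.iUnion hC
  -- Over points where `V \ B` has a unique point in the fibre, that point gives one more section,
  -- so maximality of `C V` makes this set of points null.
  have hnull : ∀ V : ι, μ {x | ∃! z, z ∈ (V : Set Z) \ B ∧ p z = x} = 0 := by
    intro V
    have hVB := (hopen V).measurableSet.diff hBm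
    obtain ⟨D, hDs, hD, hDae⟩ :=
      (nullMeasurableSet_existsUnique (μ := μ) hpm hVB).exists_measurable_subset_ae_eq
    rw [← measure_congr hDae]
    have hcov : FibresCovered μ p ((V : Set Z) ∩ p ⁻¹' D) := by
      have hinj : InjOn p (((V : Set Z) \ B) ∩ p ⁻¹' D) := by
        intro z hz w hw hzw
        obtain ⟨v, -, hv⟩ := hDs hz.2
        exact (hv z ⟨hz.1, rfl⟩).trans (hv w ⟨hw.1, hzw.symm⟩).symm
      refine (hB.union (FibresCovered.of_injOn hpm (hVB.inter (hpm hD)) hinj)).mono ?_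
      intro z hz
      by_cases hzB : z ∈ B
      exacts [Or.inl hzB, Or.inr ⟨⟨hz.1, hzB⟩, hz.2⟩]
    have hdisj : D \ C V = D := by
      refine sdiff_eq_left.2 (disjoint_left.2 fun x hx hxC => ?_)
      obtain ⟨z, ⟨hz, rfl⟩, -⟩ := hDs hx
      exact hz.2 (mem_iUnion.2 ⟨V, hz.1, hxC⟩)
    exact hdisj ▸ hCmax V D hD hcov
  have hcompl : ∀ᵐ x ∂μ, ∀ z ∈ Bᶜ, p z ≠ x := by
    have h := ae_all_iff.2 fun V => measure_eq_zero_iff_ae_notMem.1 (hnull V)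
    filter_upwards [h, hc] with x hx hxc z hz hzx
    -- The part of the fibre outside `B` is closed and countable. If nonempty, it would have a point
    -- isolated by some basic `V`, which `hnull` excludes.
    have hclosed : IsClosed (p ⁻¹' {x} \ ⋃ V ∈ {V : ι | x ∈ C V}, (V : Set Z)) :=
      (isClosed_singleton.preimage hp).sdiff (isOpen_biUnion fun V _ => hopen V)
    have heq : p ⁻¹' {x} \ ⋃ V ∈ {V : ι | x ∈ C V}, (V : Set Z) = {z | z ∉ B ∧ p z = x} := by
      ext w
      simp only [B, Set.mem_sdiff, mem_preimage, mem_singleton_iff, mem_iUnion, mem_ofPred_eq,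
        mem_inter_iff, exists_prop, not_exists, not_and]
      constructor
      · rintro ⟨rfl, h⟩
        exact ⟨fun V hV hC => h V hC hV, rfl⟩
      · rintro ⟨h, rfl⟩
        exact ⟨rfl, fun V hC hV => h V hV hC⟩
    rw [heq] at hclosed
    obtain ⟨V, hV, w, hw⟩ := exists_basis_inter_eq_singleton hclosed
      (hxc.mono fun z hz => hz.2) ⟨z, hz, hzx⟩
    refine hx ⟨V, hV⟩ ⟨w, ?_, fun v hv => ?_⟩
    · have hw' : w ∈ V ∩ {z | z ∉ B ∧ p z = x} := hw ▸ mem_singleton w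
      exact ⟨⟨hw'.1, hw'.2.1⟩, hw'.2.2⟩
    · have : v ∈ V ∩ {z | z ∉ B ∧ p z = x} := ⟨hv.1.1, hv.1.2, hv.2⟩
      rwa [hw] at this
  obtain ⟨g, hg, hgB⟩ := hB
  refine ⟨g, hg, ?_⟩
  filter_upwards [hgB, hcompl] with x hx hxc z _ hzx
  exact hx z (by_contra fun hz => hxc z hz hzx) hzx

/-- **Lusin–Novikov**, almost everywhere: a Borel map with countable fibres has countably many Borel
sections that exhaust almost every fibre. -/
theorem fibresCovered_univ [StandardBorelSpace X] [StandardBorelSpace Z] [Nonempty Z]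
    [IsFiniteMeasure μ] (hp : Measurable p) (hc : ∀ᵐ x ∂μ, (p ⁻¹' {x}).Countable) :
    FibresCovered μ p univ := by
  let := upgradeStandardBorel X
  obtain ⟨tZ, hZb, hZp⟩ := StandardBorelSpace.polish (α := Z)
  -- A finer Polish topology makes `p` continuous without changing the Borel sets.
  obtain ⟨t, ht, hpt, htP⟩ := hp.exists_continuous
  have hborel : @BorelSpace Z t _ :=
    @BorelSpace.mk Z t _ ((hZb.measurable_eq).trans
      (borel_eq_borel_of_le htP hZp ht).symm)
  exact @fibresCovered_univ_of_continuous X Z _ _ μ p _ _ _ t htP hborel _ _ hpt hp hc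

/-- **Lusin–Novikov**, almost everywhere: a Borel set with countable vertical sections is contained
in countably many Borel graphs, up to a null set of the base. -/
theorem exists_measurable_graph_cover {X Y : Type*} [MeasurableSpace X] [StandardBorelSpace X]
    [MeasurableSpace Y] [StandardBorelSpace Y] [Nonempty Y] (μ : Measure X) [IsFiniteMeasure μ]
    {A : Set (X × Y)} (hA : MeasurableSet A) (hc : ∀ᵐ x ∂μ, {y | (x, y) ∈ A}.Countable) :
    ∃ g : ℕ → X → Y, (∀ n, Measurable (g n)) ∧
      ∀ᵐ x ∂μ, ∀ y, (x, y) ∈ A → ∃ n, g n x = y := by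
  rcases A.eq_empty_or_nonempty with rfl | hne
  · exact ⟨fun _ _ => Classical.arbitrary Y, fun _ => measurable_const,
      Eventually.of_forall fun x y h => absurd h (notMem_empty _)⟩
  have := hA.standardBorel
  have := hne.to_subtype
  have hp : Measurable fun z : A => (z : X × Y).1 := measurable_fst.comp measurable_subtype_coe
  obtain ⟨g, hg, hgA⟩ := fibresCovered_univ (μ := μ) hp <| by
    filter_upwards [hc] with x hx
    refine MapsTo.countable_of_injOn (f := fun z : A => (z : X × Y).2) ?_ ?_ hx
    · rintro ⟨⟨x', y⟩, hz⟩ (rfl : x' = x)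
      exact hz
    · rintro ⟨⟨x', y⟩, hz⟩ (rfl : x' = x) ⟨⟨x'', y'⟩, hz'⟩ (rfl : x'' = x') h
      exact Subtype.ext (Prod.ext rfl h)
  refine ⟨fun n x => (g n x : X × Y).2,
    fun n => measurable_snd.comp (measurable_subtype_coe.comp (hg n)), ?_⟩
  filter_upwards [hgA] with x hx y hy
  obtain ⟨n, hn⟩ := hx ⟨(x, y), hy⟩ (mem_univ _) rfl
  exact ⟨n, by rw [hn]⟩

end FibresCovered

end MeasureTheory

/-! ### Class counts and involutions in the full group -/

namespace MeasuredRel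

open Set Filter

universe u

variable {X : Type u} {R S : Setoid X}

theorem toENNReal_encard_le_one {Y : Type*} {s : Set Y} (hs : s.Subsingleton) :
    ((s.encard : ℕ∞) : ℝ≥0∞) ≤ 1 := by
  exact_mod_cast encard_le_one_iff_subsingleton.2 hs

theorem one_le_toENNReal_encard {Y : Type*} {s : Set Y} (hs : s.Nonempty) :
    1 ≤ ((s.encard : ℕ∞) : ℝ≥0∞) := by
  exact_mod_cast one_le_encard_iff_nonempty.2 hs

open Classical in
/-- The involution that exchanges `x ∈ U` with `g x ∉ U` where `h (g x) = x`, and is the identity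
elsewhere. -/
noncomputable def exchange (R : Setoid X) (g h : X → X) (U : Set X) (x : X) : X :=
  if x ∈ U ∧ g x ∉ U ∧ h (g x) = x ∧ R x (g x) then g x
  else if x ∉ U ∧ h x ∈ U ∧ g (h x) = x ∧ R x (h x) then h x
  else x

theorem exchange_of_mem {g h : X → X} {U : Set X} {x : X} (h1 : x ∈ U) (h2 : g x ∉ U)
    (h3 : h (g x) = x) (h4 : R x (g x)) : exchange R g h U x = g x :=
  if_pos ⟨h1, h2, h3, h4⟩

theorem exchange_of_notMem {g h : X → X} {U : Set X} {x : X} (h1 : x ∉ U) (h2 : h x ∈ U)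
    (h3 : g (h x) = x) (h4 : R x (h x)) : exchange R g h U x = h x := by
  rw [exchange, if_neg fun H => h1 H.1, if_pos ⟨h1, h2, h3, h4⟩]

theorem exchange_involutive (R : Setoid X) (g h : X → X) (U : Set X) :
    Function.Involutive (exchange R g h U) := by
  intro x
  by_cases hP : x ∈ U ∧ g x ∉ U ∧ h (g x) = x ∧ R x (g x)
  · obtain ⟨h1, h2, h3, h4⟩ := hP
    rw [exchange_of_mem h1 h2 h3 h4, exchange_of_notMem h2 (h3.symm ▸ h1) (by rw [h3])
      (h3.symm ▸ R.symm' h4), h3]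
  by_cases hQ : x ∉ U ∧ h x ∈ U ∧ g (h x) = x ∧ R x (h x)
  · obtain ⟨h1, h2, h3, h4⟩ := hQ
    rw [exchange_of_notMem h1 h2 h3 h4, exchange_of_mem h2 (h3.symm ▸ h1) (by rw [h3])
      (h3.symm ▸ R.symm' h4), h3]
  · have : exchange R g h U x = x := by rw [exchange, if_neg hP, if_neg hQ]
    rw [this, this]

theorem rel_exchange (R : Setoid X) (g h : X → X) (U : Set X) (x : X) :
    R x (exchange R g h U x) := by
  unfold exchange
  split_ifs with h1 h2
  exacts [h1.2.2.2, h2.2.2.2, R.refl' x]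

/-- The number of `S`-classes of points of `E ∩ [x]_R`. -/
noncomputable def classCount (R S : Setoid X) (E : Set X) (x : X) : ℕ∞ :=
  ((fun y => Quotient.mk S y) '' {y | R x y ∧ y ∈ E}).encard

theorem classCount_congr (S : Setoid X) (E : Set X) {x y : X} (h : R x y) :
    classCount R S E x = classCount R S E y := by
  have : {z | R x z ∧ z ∈ E} = {z | R y z ∧ z ∈ E} :=
    Set.ext fun z => and_congr_left fun _ =>
      ⟨fun hz => R.trans' (R.symm' h) hz, fun hz => R.trans' h hz⟩
  rw [classCount, this, classCount]

/-- This replaces the index, seen only from `E`, by an `R`-invariant function on all of `X`, to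
which ergodicity applies. -/
theorem encard_cosets_restrictRel (R S : Setoid X) (E : Set X) (x : E) :
    (cosets (restrictRel R E) (restrictRel S E) x).encard = classCount R S E x := by
  let f : Quotient (restrictRel S E) → Quotient S :=
    Quotient.map Subtype.val fun _ _ h => h
  have hf : Function.Injective f := by
    rintro ⟨a⟩ ⟨b⟩ h
    exact Quotient.sound (s := restrictRel S E) (Quotient.exact (s := S) h)
  rw [← hf.encard_image, classCount, cosets, image_image]
  congr 1
  ext c
  constructor
  · rintro ⟨y, hy, rfl⟩
    exact ⟨y, ⟨hy, y.2⟩, rfl⟩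
  · rintro ⟨y, ⟨hy, hyE⟩, rfl⟩
    exact ⟨⟨y, hyE⟩, hy, rfl⟩

/-- Witnessing the count by `k`-tuples of points makes its superlevel sets projections from `X ×
X^k`. -/
theorem le_classCount_iff {E : Set X} {x : X} {k : ℕ} :
    (k : ℕ∞) ≤ classCount R S E x ↔
      ∃ f : Fin k → X, (∀ i, R x (f i) ∧ f i ∈ E) ∧ ∀ i j, i ≠ j → ¬ S (f i) (f j) := by
  constructor
  · intro h
    obtain ⟨t, ht, htk⟩ := exists_subset_encard_eq h
    have htf : t.Finite := finite_of_encard_eq_coe htk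
    have hcard : t.ncard = k := by rw [ncard, htk]; rfl
    have := htf.to_subtype
    let e : Fin k ≃ t := (Finite.equivFinOfCardEq hcard).symm
    choose f hf hfe using fun i => ht (e i).2
    refine ⟨f, hf, fun i j hij hS => hij (e.injective (Subtype.ext ?_))⟩
    rw [← hfe i, ← hfe j]
    exact Quotient.sound hS
  · rintro ⟨f, hf, hfS⟩
    have hinj : Function.Injective fun i => Quotient.mk S (f i) := fun i j hij =>
      by_contra fun hne => hfS i j hne (Quotient.exact hij)
    have := hinj.encard_range
    rw [ENat.card_eq_coe_fintype_card, Fintype.card_fin] at this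
    refine this.trans (encard_le_encard ?_)
    rintro _ ⟨i, rfl⟩
    exact ⟨f i, hf i, rfl⟩

variable [MeasurableSpace X] {μ : Measure X}

/-- A set whose vertical sections over `C` are nonempty has mass at least `μ C`. -/
theorem measure_le_relMass {A : Set (X × X)} {C : Set X} (hC : NullMeasurableSet C μ)
    (hA : ∀ x ∈ C, ∃ y, (x, y) ∈ A) : μ C ≤ relMass μ A := by
  rw [← lintegral_indicator_one₀ hC]
  refine lintegral_mono fun x => ?_
  by_cases hx : x ∈ C
  · rw [indicator_of_mem hx]
    exact one_le_toENNReal_encard (hA x hx)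
  · rw [indicator_of_notMem hx]
    exact zero_le

/-- A set whose vertical sections have at most one point, and are empty off `C`, has mass at most
`μ C`. -/
theorem relMass_le_measure {A : Set (X × X)} {C : Set X} (hC : NullMeasurableSet C μ)
    (hA : ∀ x y, (x, y) ∈ A → x ∈ C) (hA' : ∀ x y z, (x, y) ∈ A → (x, z) ∈ A → y = z) :
    relMass μ A ≤ μ C := by
  rw [← lintegral_indicator_one₀ hC]
  refine lintegral_mono fun x => ?_
  by_cases hx : x ∈ C
  · rw [indicator_of_mem hx]
    exact toENNReal_encard_le_one fun y hy z hz => hA' x y z hy hz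
  · rw [indicator_of_notMem hx]
    have : {y | (x, y) ∈ A} = ∅ := eq_empty_of_forall_notMem fun y hy => hx (hA x y hy)
    simp [this]

theorem id_mem_fullGroup : (1 : Equiv.Perm X) ∈ fullGroup μ R :=
  ⟨fun _ hA => hA, fun A hA => by simpa using hA, Eventually.of_forall fun x => R.refl' x⟩

/-- The index of `S|_E` in `R|_E` in terms of `μ` itself. -/
theorem hasIndex_restrict_iff [IsFiniteMeasure μ] {E : Set X} (hE : NullMeasurableSet E μ) (n : ℕ∞) :
    HasIndex (restrictMeasure μ E) (restrictRel R E) (restrictRel S E) n ↔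
      ∀ᵐ x ∂μ, x ∈ E → classCount R S E x = n := by
  unfold HasIndex restrictMeasure
  -- Scaling by a nonzero constant preserves null sets, even by `∞` when `μ E = 0`.
  rw [Measure.ae_ennreal_smul_measure_iff (ENNReal.inv_ne_zero.2 (measure_ne_top μ E))]
  simp only [encard_cosets_restrictRel]
  constructor
  · intro h
    have := Measure.measure_subtype_coe_eq_zero_of_comap_eq_zero hE (ae_iff.1 h)
    filter_upwards [measure_eq_zero_iff_ae_notMem.1 this] with x hx hxE
    by_contra hne
    exact hx ⟨⟨x, hxE⟩, hne, rfl⟩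
  · intro h
    obtain ⟨N, hsub, hN, hN0⟩ := exists_measurable_superset_of_null (ae_iff.1 h)
    rw [ae_iff]
    refine measure_mono_null (t := Subtype.val ⁻¹' N) (fun x hx => hsub fun h => hx (h x.2)) ?_
    rw [Measure.comap_apply₀ _ _ Subtype.val_injective
      (fun _ => Measure.MeasurableSet.nullMeasurableSet_subtype_coe hE)
      (measurable_subtype_coe hN).nullMeasurableSet]
    exact measure_mono_null (image_preimage_subset _ _) hN0

variable [StandardBorelSpace X]

/-- A Borel involution with graph in `R` preserves `μ`. -/
theorem IsDiscreteMP.measurePreserving (hR : IsDiscreteMP μ R) {γ : X → X}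
    (hγ : Measurable γ) (hinv : Function.Involutive γ) (hγR : ∀ x, R x (γ x)) :
    MeasurePreserving γ μ μ := by
  refine ⟨hγ, Measure.ext fun C hC => ?_⟩
  rw [Measure.map_apply hγ hC]
  have hle : ∀ C : Set X, MeasurableSet C → μ C ≤ μ (γ ⁻¹' C) := by
    intro C hC
    -- The graph of `γ` over `C`. As `γ` is an involution, its flip lies over `γ ⁻¹' C` with at most
    -- one point in each section.
    let A : Set (X × X) := {q | q.1 ∈ C} ∩ {q | q.2 = γ q.1}
    have hA : MeasurableSet A := (measurable_fst hC).inter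
      (measurableSet_eq_fun measurable_snd (hγ.comp measurable_fst))
    have hAR : A ⊆ {q | R q.1 q.2} := by
      rintro ⟨x, y⟩ ⟨hx, hy⟩
      have hy : y = γ x := hy
      exact hy ▸ hγR x
    calc μ C ≤ relMass μ A := measure_le_relMass hC.nullMeasurableSet fun x hx => ⟨γ x, hx, rfl⟩
      _ = relMass μ (Prod.swap ⁻¹' A) := (hR.flip_preserving A hA hAR).symm
      _ ≤ μ (γ ⁻¹' C) := by
        have key : ∀ y x, (y, x) ∈ Prod.swap ⁻¹' A → x ∈ C ∧ γ y = x := by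
          rintro y x ⟨hx, hy⟩
          have hy : y = γ x := hy
          exact ⟨hx, hy ▸ hinv x⟩
        refine relMass_le_measure (hγ hC).nullMeasurableSet (fun y x h => ?_)
          fun y x x' h h' => (key y x h).2.symm.trans (key y x' h').2
        change γ y ∈ C
        rw [(key y x h).2]
        exact (key y x h).1
  refine le_antisymm ?_ (hle C hC)
  have := hle _ (hγ hC)
  rwa [← preimage_comp, hinv.comp_self, preimage_id] at this

theorem IsDiscreteMP.toPerm_mem_fullGroup (hR : IsDiscreteMP μ R) {γ : X → X}
    (hγ : Measurable γ) (hinv : Function.Involutive γ) (hγR : ∀ x, R x (γ x)) :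
    hinv.toPerm ∈ fullGroup μ R := by
  have h : ∀ A : Set X, NullMeasurableSet A μ → NullMeasurableSet (γ ⁻¹' A) μ := fun A hA =>
    hA.preimage (hR.measurePreserving hγ hinv hγR).quasiMeasurePreserving
  refine ⟨h, fun A hA => ?_, Eventually.of_forall hγR⟩
  rw [Equiv.image_eq_preimage_symm]
  exact h A hA

theorem measurable_exchange (hR : MeasurableSet {p : X × X | R p.1 p.2}) {g h : X → X}
    (hg : Measurable g) (hh : Measurable h) {U : Set X} (hU : MeasurableSet U) :
    Measurable (exchange R g h U) := by
  have hRm : ∀ f : X → X, Measurable f → MeasurableSet {x | R x (f x)} := fun f hf =>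
    (measurable_id.prodMk hf) hR
  refine Measurable.ite ?_ hg (Measurable.ite ?_ hh measurable_id)
  · exact hU.inter ((hg hU).compl.inter
      ((measurableSet_eq_fun (hh.comp hg) measurable_id).inter (hRm g hg)))
  · exact hU.compl.inter ((hh hU).inter
      ((measurableSet_eq_fun (hg.comp hh) measurable_id).inter (hRm h hh)))

variable [IsProbabilityMeasure μ]

/-! ### Null saturations and the Feldman–Moore cover -/

/-- The saturation of a null set is null. -/
theorem IsDiscreteMP.ae_forall_rel (hR : IsDiscreteMP μ R) {p : X → Prop} (hp : ∀ᵐ x ∂μ, p x) :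
    ∀ᵐ x ∂μ, ∀ y, R x y → p y := by
  obtain ⟨N, hpN, hN, hN0⟩ := exists_measurable_superset_of_null (ae_iff.1 hp)
  -- The projection of `A` is the saturation of `N`, while the flip of `A` lives over the null set
  -- `N`.
  let A : Set (X × X) := {q | R q.1 q.2} ∩ {q | q.2 ∈ N}
  have hA : MeasurableSet A := hR.measurableSet_graph.inter (measurable_snd hN)
  have hflip := hR.flip_preserving A hA inter_subset_left
  have hswap : relMass μ (Prod.swap ⁻¹' A) = 0 := by
    have : ∀ᵐ x ∂μ, (({y | (x, y) ∈ Prod.swap ⁻¹' A}.encard : ℕ∞) : ℝ≥0∞) = 0 := by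
      filter_upwards [measure_eq_zero_iff_ae_notMem.1 hN0] with x hx
      have : {y | (x, y) ∈ Prod.swap ⁻¹' A} = ∅ := eq_empty_of_forall_notMem fun y hy => hx hy.2
      rw [this, encard_empty, ENat.toENNReal_zero]
    rw [relMass, lintegral_congr_ae this, lintegral_zero]
  have himage := hA.nullMeasurableSet_image μ measurable_fst
  have hzero : μ (Prod.fst '' A) = 0 := by
    refine le_antisymm ?_ zero_le
    rw [← hswap, hflip]
    refine measure_le_relMass himage ?_
    rintro _ ⟨q, hq, rfl⟩
    exact ⟨q.2, hq⟩
  filter_upwards [measure_eq_zero_iff_ae_notMem.1 hzero] with x hx y hxy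
  by_contra hy
  exact hx ⟨(x, y), ⟨hxy, hpN hy⟩, rfl⟩

/-- Elements of the full group satisfy `γ⁻¹ x ∈ [x]_R` almost everywhere. -/
theorem IsDiscreteMP.ae_rel_symm (hR : IsDiscreteMP μ R) {γ : Equiv.Perm X}
    (hγ : γ ∈ fullGroup μ R) : ∀ᵐ x ∂μ, R x (γ.symm x) := by
  have hnm : NullMeasurable γ μ := fun A hA => hγ.1 A hA.nullMeasurableSet
  obtain ⟨g, hg, hγg⟩ := hnm.aemeasurable
  obtain ⟨N, hsub, hN, hN0⟩ := exists_measurable_superset_of_null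
    (ae_iff.1 (hγg.and hγ.2.2))
  have hC : ∀ x ∉ N, γ x = g x ∧ R x (γ x) := fun x hx => by
    by_contra h
    exact hx (hsub h)
  -- The graph of a Borel version of `γ` over a conull set has mass at least 1. Its flip lies over
  -- `γ '' Nᶜ` with single-point sections, so this image is conull.
  let A : Set (X × X) := {q | q.1 ∈ Nᶜ} ∩ {q | q.2 = g q.1}
  have hA : MeasurableSet A := (measurable_fst hN.compl).inter
    (measurableSet_eq_fun measurable_snd (hg.comp measurable_fst))
  have hAR : A ⊆ {q | R q.1 q.2} := by
    rintro ⟨x, y⟩ ⟨hx, hy⟩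
    have hy : y = g x := hy
    have := hC x hx
    change R x y
    rw [hy, ← this.1]
    exact this.2
  have hγN : NullMeasurableSet (γ '' Nᶜ) μ := hγ.2.1 _ hN.compl.nullMeasurableSet
  have h1 : μ Nᶜ ≤ relMass μ A :=
    measure_le_relMass hN.compl.nullMeasurableSet fun x hx => ⟨g x, hx, rfl⟩
  have h2 : relMass μ (Prod.swap ⁻¹' A) ≤ μ (γ '' Nᶜ) := by
    have key : ∀ y x, (y, x) ∈ Prod.swap ⁻¹' A → x ∈ Nᶜ ∧ γ x = y := by
      rintro y x ⟨hx, hy⟩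
      exact ⟨hx, (hC x hx).1.trans (Eq.symm hy)⟩
    refine relMass_le_measure hγN (fun y x h => ⟨x, key y x h⟩) fun y x x' h h' => ?_
    exact γ.injective ((key y x h).2.trans (key y x' h').2.symm)
  rw [hR.flip_preserving A hA hAR] at h2
  have h3 : μ (γ '' Nᶜ) = 1 := by
    refine le_antisymm prob_le_one ?_
    rw [← (prob_compl_eq_one_iff hN).2 hN0]
    exact h1.trans h2
  have h4 : μ (γ '' Nᶜ)ᶜ = 0 := (prob_compl_eq_zero_iff₀ hγN).2 h3
  filter_upwards [measure_eq_zero_iff_ae_notMem.1 h4] with y hy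
  obtain ⟨x, hx, rfl⟩ := not_not.1 hy
  rw [Equiv.symm_apply_apply]
  exact R.symm' (hC x hx).2

/-- **Feldman–Moore**, almost everywhere: the graphs of countably many involutions of the full group cover
`R` over almost every point. -/
theorem IsDiscreteMP.exists_involutive_cover (hR : IsDiscreteMP μ R) :
    ∃ (ι : Type) (_ : Countable ι) (γ : ι → Equiv.Perm X), (∀ i, γ i ∈ fullGroup μ R) ∧
      (∀ i, (γ i).symm = γ i) ∧ ∀ᵐ x ∂μ, ∀ y, R x y → ∃ i, γ i x = y := by
  have := μ.nonempty_of_neZero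
  obtain ⟨g, hg, hgR⟩ := exists_measurable_graph_cover μ hR.measurableSet_graph hR.ae_countable
  let e := MeasurableSpace.mapNatBool X
  -- Countably many sets separating points: `exchange` needs `x ∈ U` and `y ∉ U` in order to swap
  -- distinct `x` and `y`.
  let U : ℕ → Bool → Set X := fun k b => {x | e x k = b}
  have hU : ∀ k b, MeasurableSet (U k b) := fun k b =>
    ((measurable_pi_apply k).comp (MeasurableSpace.measurable_mapNatBool X))
      (measurableSet_singleton b)
  refine ⟨ℕ × ℕ × ℕ × Bool, inferInstance, fun i =>
    (exchange_involutive R (g i.1) (g i.2.1) (U i.2.2.1 i.2.2.2)).toPerm, fun i =>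
      hR.toPerm_mem_fullGroup (measurable_exchange hR.measurableSet_graph (hg _) (hg _) (hU _ _))
        _ (rel_exchange R _ _ _), fun i => rfl, ?_⟩
  filter_upwards [hR.ae_forall_rel hgR] with x hx y hxy
  obtain ⟨n, hn⟩ := hx x (R.refl' x) y hxy
  obtain ⟨m, hm⟩ := hx y hxy x (R.symm' hxy)
  by_cases hne : x = y
  · subst hne
    -- As `g n x = x`, every branch of `exchange` returns `x`; the last two indices are arbitrary.
    refine ⟨(n, n, 0, e x 0), ?_⟩
    change exchange R (g n) (g n) (U 0 (e x 0)) x = x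
    unfold exchange
    split_ifs
    exacts [hn, hn, rfl]
  · obtain ⟨k, hk⟩ := Function.ne_iff.1 fun h => hne (MeasurableSpace.injective_mapNatBool X h)
    refine ⟨(n, m, k, e x k), ?_⟩
    change exchange R (g n) (g m) (U k (e x k)) x = y
    have hy : y ∉ U k (e x k) := fun h => hk (Eq.symm h)
    rw [exchange_of_mem (show x ∈ U k (e x k) from rfl) (hn.symm ▸ hy) (by rw [hn, hm])
      (hn.symm ▸ hxy), hn]

/-- After `E` is replaced by a Borel set, which alters counts only over the saturation of a null
set, this is the projection of a Borel set of tuples. -/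
theorem nullMeasurableSet_le_classCount (hR : IsDiscreteMP μ R) (hS : IsDiscreteMP μ S)
    {E : Set X} (hE : NullMeasurableSet E μ) (k : ℕ) :
    NullMeasurableSet {x | (k : ℕ∞) ≤ classCount R S E x} μ := by
  obtain ⟨F, -, hF, hFE⟩ := hE.exists_measurable_subset_ae_eq
  have hae : ∀ᵐ x ∂μ, classCount R S F x = classCount R S E x := by
    filter_upwards [hR.ae_forall_rel (eventuallyEq_set.1 hFE)] with x hx
    have : {y | R x y ∧ y ∈ F} = {y | R x y ∧ y ∈ E} :=
      Set.ext fun y => and_congr_right fun h => hx y h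
    rw [classCount, this, classCount]
  let T : Set (X × (Fin k → X)) :=
    {q | (∀ i, R q.1 (q.2 i) ∧ q.2 i ∈ F) ∧ ∀ i j, i ≠ j → ¬ S (q.2 i) (q.2 j)}
  have hev : ∀ i, Measurable fun q : X × (Fin k → X) => q.2 i := fun i =>
    (measurable_pi_apply i).comp measurable_snd
  have hT : MeasurableSet T := by
    refine MeasurableSet.inter ?_ ?_
    · refine MeasurableSet.congr (MeasurableSet.iInter fun i =>
        ((measurable_fst.prodMk (hev i)) hR.measurableSet_graph).inter ((hev i) hF)) ?_
      ext q
      simp only [mem_iInter]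
      rfl
    · refine MeasurableSet.congr (MeasurableSet.iInter fun i => MeasurableSet.iInter fun j =>
        MeasurableSet.iInter fun _ : i ≠ j =>
          (((hev i).prodMk (hev j)) hS.measurableSet_graph).compl) ?_
      ext q
      simp only [mem_iInter]
      rfl
  refine (hT.nullMeasurableSet_image μ measurable_fst).congr (eventuallyEq_set.2 ?_)
  filter_upwards [hae] with x hx
  rw [← hx, le_classCount_iff]
  constructor
  · rintro ⟨⟨_, f⟩, hq, rfl⟩
    exact ⟨f, hq⟩
  · rintro ⟨f, hf⟩
    exact ⟨(x, f), hf, rfl⟩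

theorem nullMeasurableSet_classCount_eq (hR : IsDiscreteMP μ R) (hS : IsDiscreteMP μ S)
    {E : Set X} (hE : NullMeasurableSet E μ) (n : ℕ) :
    NullMeasurableSet {x | classCount R S E x = n} μ := by
  convert (nullMeasurableSet_le_classCount hR hS hE n).diff
    (nullMeasurableSet_le_classCount hR hS hE (n + 1)) using 1
  ext x
  simp only [mem_ofPred_eq, Set.mem_sdiff, not_le, Nat.cast_add, Nat.cast_one]
  rw [ENat.lt_add_one_iff (ENat.natCast_ne_top n), and_comm, le_antisymm_iff]

/-- If finitely many `S`-classes, `n` in number, meet the `R`-classes of the points of a non-null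
set, then this holds almost everywhere, by ergodicity. -/
theorem ae_classCount_eq (hR : IsDiscreteMP μ R) (hS : IsDiscreteMP μ S) (hErg : IsErgodic μ R)
    {E : Set X} (hE : NullMeasurableSet E μ) {n : ℕ} (h : μ {x | classCount R S E x = n} ≠ 0) :
    ∀ᵐ x ∂μ, classCount R S E x = n :=
  (hErg _ (nullMeasurableSet_classCount_eq hR hS hE n) fun _ _ hxy hx =>
    (classCount_congr S E hxy).symm.trans hx).resolve_left h

end MeasuredRel

/-! ### Invariant vectors versus finite index -/

namespace MeasuredRel

open Set Filter

universe u

section Algebra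

variable {X : Type u} {R S : Setoid X}

theorem coeff_of_rel (ξ : ∀ x, Fibre R S x) {x y : X} (h : R x y) :
    coeff R S ξ x y = ξ x ⟨Quotient.mk S y, mk_mem_cosets R S h⟩ :=
  dif_pos h

theorem fullGroupAct_of_rel (γ : Equiv.Perm X) (ξ : ∀ x, Fibre R S x) {x : X}
    (h : R x (γ.symm x)) :
    fullGroupAct R S γ ξ x = quasiRegular R S h (ξ (γ.symm x)) :=
  dif_pos h

theorem quasiRegular_apply {x y : X} (h : R x y) (v : Fibre R S y) (c : cosets R S x) :
    quasiRegular R S h v c = v ⟨c.1, (cosets_eq R S h).symm ▸ c.2⟩ :=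
  lpCast_apply _ _ _

/-- Square-summability is what makes the level sets of an invariant vector meet finitely many
classes. -/
theorem finite_setOf_lt_norm {ι : Type*} (f : lp (fun _ : ι => ℂ) 2) {ε : ℝ} (hε : 0 < ε) :
    {c | ε < ‖f c‖}.Finite := by
  have h := ((lp.memℓp f).summable (by norm_num)).tendsto_cofinite_zero.eventually
    (gt_mem_nhds (Real.rpow_pos_of_pos hε (2 : ℝ≥0∞).toReal))
  exact (eventually_cofinite.1 h).subset fun c hc =>
    not_lt.2 (Real.rpow_le_rpow hε.le (le_of_lt hc) (by norm_num))

open Classical in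
/-- The family of the indicator functions of the set of `S`-classes that meet `E`, in the fibres
where exactly `n` of them do. -/
noncomputable def classIndicator (R S : Setoid X) (E : Set X) (n : ℕ) (x : X) : Fibre R S x :=
  if h : classCount R S E x = n then
    ⟨fun c : cosets R S x => if ∃ y ∈ E, Quotient.mk S y = c.1 ∧ R x y then (1 : ℂ) else 0, by
      refine memℓp_gen (summable_of_hasFiniteSupport ?_)
      refine Set.Finite.subset ((finite_of_encard_eq_coe h).preimage
        (f := fun c : cosets R S x => c.1) Subtype.val_injective.injOn) fun c hc => ?_
      by_contra hc'
      refine hc ?_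
      dsimp only
      rw [if_neg, norm_zero, Real.zero_rpow (by norm_num)]
      rintro ⟨y, hy, hyc, hxy⟩
      exact hc' ⟨y, ⟨hxy, hy⟩, hyc⟩⟩
  else 0

open Classical in
theorem classIndicator_apply {E : Set X} {n : ℕ} {x : X} (h : classCount R S E x = n)
    (c : cosets R S x) : classIndicator R S E n x c =
      if ∃ y ∈ E, Quotient.mk S y = c.1 ∧ R x y then 1 else 0 := by
  rw [classIndicator, dif_pos h]

open Classical in
-- By `S`-invariance, a class that meets `E` is contained in `E`.
theorem coeff_classIndicator {E : Set X} (hE : IsInvariant S E)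
    {n : ℕ} {x y : X} (h : classCount R S E x = n) (hxy : R x y) :
    coeff R S (classIndicator R S E n) x y = if y ∈ E then 1 else 0 := by
  rw [coeff_of_rel _ hxy, classIndicator_apply h]
  refine if_congr ⟨?_, fun hy => ⟨y, hy, rfl, hxy⟩⟩ rfl rfl
  rintro ⟨z, hz, hzy, -⟩
  exact hE z y (Quotient.exact hzy) hz

/-- Both the count and the set of classes meeting `E` depend only on the `R`-class. -/
theorem quasiRegular_classIndicator (E : Set X) (n : ℕ) {x y : X} (h : R x y) :
    quasiRegular R S h (classIndicator R S E n y) = classIndicator R S E n x := by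
  classical
  have hcount := classCount_congr S E h
  by_cases hn : classCount R S E x = n
  · refine lp.ext (funext fun c => ?_)
    rw [quasiRegular_apply, classIndicator_apply hn, classIndicator_apply (hcount ▸ hn)]
    have : ∀ z, R y z ↔ R x z := fun z =>
      ⟨fun hz => R.trans' h hz, fun hz => R.trans' (R.symm' h) hz⟩
    exact if_congr (by simp only [this]) rfl rfl
  · rw [classIndicator, classIndicator, dif_neg hn, dif_neg (hcount ▸ hn), map_zero]

theorem enorm_classIndicator_sq_le (E : Set X) (n : ℕ) (x : X) :
    ‖classIndicator R S E n x‖ₑ ^ 2 ≤ n := by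
  by_cases hn : classCount R S E x = n
  swap
  · rw [classIndicator, dif_neg hn]
    simp
  have hfin : ((fun y => Quotient.mk S y) '' {y | R x y ∧ y ∈ E}).Finite :=
    finite_of_encard_eq_coe hn
  have hpre := hfin.preimage (f := fun c : cosets R S x => c.1) Subtype.val_injective.injOn
  have hcard : hpre.toFinset.card ≤ n := by
    rw [← ncard_eq_toFinset_card _ hpre]
    have h1 := ncard_preimage_of_injective_subset_range
      (s := (fun y => Quotient.mk S y) '' {y | R x y ∧ y ∈ E})
      (Subtype.val_injective : Function.Injective fun c : cosets R S x => c.1) ?_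
    · rw [h1, ncard]
      change (classCount R S E x).toNat ≤ n
      rw [hn]
      rfl
    · rintro _ ⟨y, ⟨hxy, -⟩, rfl⟩
      exact ⟨⟨_, mk_mem_cosets R S hxy⟩, rfl⟩
  have hnorm : ‖classIndicator R S E n x‖ ^ 2 ≤ n := by
    have h2 := lp.norm_rpow_eq_tsum (p := 2) (by norm_num) (classIndicator R S E n x)
    rw [tsum_eq_sum (s := hpre.toFinset)] at h2
    · have h3 : ∑ c ∈ hpre.toFinset, ‖classIndicator R S E n x c‖ ^ (2 : ℝ≥0∞).toReal ≤
          ∑ c ∈ hpre.toFinset, 1 := by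
        refine Finset.sum_le_sum fun c _ => ?_
        rw [classIndicator_apply hn]
        split_ifs <;> simp
      rw [Finset.sum_const, nsmul_eq_mul, mul_one] at h3
      have h4 : ‖classIndicator R S E n x‖ ^ (2 : ℝ≥0∞).toReal ≤ n :=
        h2.le.trans (h3.trans (by exact_mod_cast hcard))
      simpa using h4
    · intro c hc
      rw [classIndicator_apply hn, if_neg]
      · simp
      · rintro ⟨y, hy, hyc, hxy⟩
        exact hc (hpre.mem_toFinset.2 ⟨y, ⟨hxy, hy⟩, hyc⟩)
  rw [← ofReal_norm, ← ENNReal.ofReal_pow (norm_nonneg _)]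
  exact ENNReal.ofReal_le_natCast.2 hnorm

end Algebra

section Main

variable {X : Type u} [MeasurableSpace X] [StandardBorelSpace X] {μ : Measure X}
  [IsProbabilityMeasure μ] {R S : Setoid X}

theorem hasNonzeroInvariantVector_of_hasIndex (hR : IsDiscreteMP μ R) (hS : IsDiscreteMP μ S)
    (hErg : IsErgodic μ R) {E : Set X}
    (hE : NullMeasurableSet E μ) (hES : IsInvariant S E) (hE0 : 0 < μ E) {n : ℕ}
    (hn : HasIndex (restrictMeasure μ E) (restrictRel R E) (restrictRel S E) n) :
    HasNonzeroInvariantVector μ R S := by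
  rw [hasIndex_restrict_iff hE] at hn
  -- The hypothesis speaks only of points of `E`; ergodicity extends it to almost all of `X`.
  have hae : ∀ᵐ x ∂μ, classCount R S E x = n := by
    refine ae_classCount_eq hR hS hErg hE fun h0 => hE0.ne' ?_
    refine measure_eq_zero_iff_ae_notMem.2 ?_
    filter_upwards [hn, measure_eq_zero_iff_ae_notMem.1 h0] with x hx hx0 hxE
    exact hx0 (hx hxE)
  refine ⟨classIndicator R S E n, ⟨fun γ hγ => ?_, ?_⟩, fun h0 => hE0.ne' ?_, fun γ hγ => ?_⟩
  · have hind : AEMeasurable ((γ ⁻¹' E).indicator fun _ => (1 : ℂ)) μ :=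
      aemeasurable_const.indicator₀ (hγ.1 E hE)
    refine hind.congr ?_
    filter_upwards [hae, hγ.2.2] with x hx hxγ
    classical
    rw [coeff_classIndicator hES hx hxγ]
    rfl
  · calc ∫⁻ x, ‖classIndicator R S E n x‖ₑ ^ 2 ∂μ ≤ ∫⁻ _, (n : ℝ≥0∞) ∂μ :=
          lintegral_mono fun x => enorm_classIndicator_sq_le E n x
      _ < ∞ := by simp
  · refine measure_eq_zero_iff_ae_notMem.2 ?_
    filter_upwards [hae, h0] with x hx hx0 hxE
    have h1 := coeff_classIndicator hES hx (R.refl' x)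
    rw [coeff_of_rel _ (R.refl' x), hx0, if_pos hxE] at h1
    exact zero_ne_one h1
  · filter_upwards [hR.ae_rel_symm hγ] with x hx
    rw [fullGroupAct_of_rel γ _ hx, quasiRegular_classIndicator]

/-- An invariant vector is almost everywhere constant along the classes of `R`. -/
theorem IsDiscreteMP.ae_coeff_eq (hR : IsDiscreteMP μ R) {ξ : ∀ x, Fibre R S x}
    (hξ : ∀ γ ∈ fullGroup μ R, ∀ᵐ x ∂μ, fullGroupAct R S γ ξ x = ξ x) :
    ∀ᵐ x ∂μ, ∀ y z, R x y → R x z → coeff R S ξ y z = coeff R S ξ x z := by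
  obtain ⟨ι, _, γ, hγ, hsymm, hcover⟩ := hR.exists_involutive_cover
  -- Countability of the cover gives one null set that serves all `y ∈ [x]_R`. Since the action at
  -- `x` involves `γ⁻¹ x`, it helps that the cover consists of involutions.
  filter_upwards [hcover, ae_all_iff.2 fun i => hξ (γ i) (hγ i)] with x hx hact y z hxy hxz
  obtain ⟨i, hi⟩ := hx y hxy
  have hi' : (γ i).symm x = y := by rw [hsymm, hi]
  subst hi'
  have h := hact i
  rw [fullGroupAct_of_rel _ _ hxy] at h
  rw [coeff_of_rel _ hxz, coeff_of_rel _ (R.trans' (R.symm' hxy) hxz), ← h, quasiRegular_apply]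

theorem exists_hasIndex_of_hasNonzeroInvariantVector (hR : IsDiscreteMP μ R)
    (hS : IsDiscreteMP μ S) (hSR : ∀ x y, S x y → R x y) (hErg : IsErgodic μ R)
    (h : HasNonzeroInvariantVector μ R S) :
    ∃ E : Set X, NullMeasurableSet E μ ∧ IsInvariant S E ∧ 0 < μ E ∧
      ∃ n : ℕ, HasIndex (restrictMeasure μ E) (restrictRel R E) (restrictRel S E) n := by
  obtain ⟨ξ, ⟨hmeas, -⟩, hne, hinv⟩ := h
  let Y : Set X := {x | ∀ y z, R x y → R x z → coeff R S ξ y z = coeff R S ξ x z}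
  have hY : ∀ᵐ x ∂μ, x ∈ Y := hR.ae_coeff_eq hinv
  have hYinv : IsInvariant R Y := fun x x' hxx' hx y z hy hz =>
    (hx y z (R.trans' hxx' hy) (R.trans' hxx' hz)).trans
      (hx x' z hxx' (R.trans' hxx' hz)).symm
  have hF : AEMeasurable (fun x => coeff R S ξ x x) μ := hmeas 1 id_mem_fullGroup
  -- Intersecting with the `R`-invariant conull set `Y` makes `E k` invariant everywhere, not merely
  -- almost everywhere.
  let E : ℕ → Set X := fun k => {x | x ∈ Y ∧ 1 / ((k : ℝ) + 1) < ‖coeff R S ξ x x‖}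
  have hEm : ∀ k, NullMeasurableSet (E k) μ := fun k =>
    (NullMeasurableSet.of_compl (NullMeasurableSet.of_null hY)).inter
      (nullMeasurableSet_lt aemeasurable_const hF.norm)
  have hES : ∀ k, IsInvariant S (E k) := by
    intro k x y hxy hx
    refine ⟨hYinv x y (hSR x y hxy) hx.1, ?_⟩
    have h1 : coeff R S ξ y y = coeff R S ξ x x := by
      rw [hx.1 y y (hSR x y hxy) (hSR x y hxy), coeff_of_rel _ (R.refl' x),
        coeff_of_rel _ (hSR x y hxy)]
      exact congrArg (ξ x) (Subtype.ext (Quotient.sound (s := S) (S.symm' hxy)))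
    rw [h1]
    exact hx.2
  obtain ⟨k, hk⟩ : ∃ k, μ (E k) ≠ 0 := by
    by_contra! h0
    refine hne ?_
    -- Over almost every `x` the entire class avoids all `E k`. The diagonal coefficients at points
    -- of this class are exactly the coordinates of `ξ x`.
    filter_upwards [hY, hR.ae_forall_rel
      (ae_all_iff.2 fun k => measure_eq_zero_iff_ae_notMem.1 (h0 k))] with x hxY hx
    refine lp.ext (funext ?_)
    rintro ⟨_, y, hxy, rfl⟩
    have h1 : coeff R S ξ y y = 0 := by
      by_contra hc
      obtain ⟨k, hk⟩ := exists_nat_one_div_lt (norm_pos_iff.2 hc)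
      exact hx y hxy k ⟨hYinv x y hxy hxY, hk⟩
    rw [hxY y y hxy hxy, coeff_of_rel _ hxy] at h1
    exact h1
  have hfin : ∀ x ∈ Y, ∃ n : ℕ, classCount R S (E k) x = n := by
    intro x hx
    have hfin : ((fun y => Quotient.mk S y) '' {y | R x y ∧ y ∈ E k}).Finite := by
      refine ((finite_setOf_lt_norm (ξ x) (Nat.one_div_pos_of_nat (n := k))).image
        Subtype.val).subset ?_
      rintro _ ⟨y, ⟨hxy, -, hy⟩, rfl⟩
      rw [hx y y hxy hxy, coeff_of_rel _ hxy] at hy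
      exact ⟨⟨_, mk_mem_cosets R S hxy⟩, hy, rfl⟩
    exact ⟨_, hfin.cast_ncard_eq.symm⟩
  -- The conull set `Y` is covered by countably many level sets of the count, so one of them is
  -- non-null.
  obtain ⟨n, hn⟩ : ∃ n : ℕ, μ {x | classCount R S (E k) x = n} ≠ 0 := by
    by_contra! h0
    have hfalse : ∀ᵐ x ∂μ, False := by
      filter_upwards [hY, ae_all_iff.2 fun n => measure_eq_zero_iff_ae_notMem.1 (h0 n)]
        with x hx hx0
      obtain ⟨n, hn⟩ := hfin x hx
      exact hx0 n hn
    obtain ⟨_, h⟩ := hfalse.exists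
    exact h
  refine ⟨E k, hEm k, hES k, pos_iff_ne_zero.2 hk, n, (hasIndex_restrict_iff (hEm k) n).2 ?_⟩
  filter_upwards [ae_classCount_eq hR hS hErg (hEm k) hn] with x hx _
  exact hx

end Main

end MeasuredRel

theorem mainTheorem8 {X : Type*} [MeasurableSpace X] [StandardBorelSpace X]
    (μ : Measure X) [IsProbabilityMeasure μ] (R S : Setoid X)
    (hR : MeasuredRel.IsDiscreteMP μ R) (hS : MeasuredRel.IsDiscreteMP μ S)
    (hSR : ∀ x y, S x y → R x y) (hErg : MeasuredRel.IsErgodic μ R) :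
    MeasuredRel.HasNonzeroInvariantVector μ R S ↔
      ∃ E : Set X, NullMeasurableSet E μ ∧ MeasuredRel.IsInvariant S E ∧ 0 < μ E ∧
        ∃ n : ℕ, MeasuredRel.HasIndex (MeasuredRel.restrictMeasure μ E)
          (MeasuredRel.restrictRel R E) (MeasuredRel.restrictRel S E) n := by
  constructor
  · exact MeasuredRel.exists_hasIndex_of_hasNonzeroInvariantVector hR hS hSR hErg
  · rintro ⟨E, hE, hES, hE0, n, hn⟩
    exact MeasuredRel.hasNonzeroInvariantVector_of_hasIndex hR hS hErg hE hES hE0 hn
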